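/- Let $k$ be a field of characteristic zero, $H=\bigoplus_{n\ge 0}H_n$ a connected graded commutative Hopf algebra over $k$ (connected: $H_0=k\cdot 1$), and $A$ a commutative unital $k$-algebra. Let $\mathrm{Hom}(H,A)$ be the algebra of $k$-linear maps $H\to A$ with the convolution product $*$ and unit $\eta_A\colon h\mapsto\varepsilon(h)1_A$, with the decreasing filtration $$\mathrm{Hom}(H,A)^n=\{f : f|_{H_m}=0 \text{ for all } m<n\},$$ and the topology given by this filtration. Let $G_H(A)$ be the set of characters (unital algebra homomorphisms $H\to A$), and $g_H(A)$ the space of infinitesimal characters, i.e. of all $L\in\mathrm{Hom}(H,A)$ with $L(cd)=\varepsilon(c)L(d)+\varepsilon(d)L(c)$. Let $\exp$ and $\log$ be given by the usual power series for the convolution product, and let $\mathrm{CBHD}(x,y)=\sum_{m\ge 2}\Phi_m(x,y)$, where $\Phi_m(x,y)$ is the homogeneous component of degree $m$ of $\log(e^xe^y)$. Let $P$ be any $k$-linear map on $\mathrm{Hom}(H,A)$ with $P(\mathrm{Hom}(H,A)^n)\subseteq\mathrm{Hom}(H,A)^n$ for all $n$, and $\tilde P=\mathrm{id}-P$. For $a\in\mathrm{Hom}(H,A)^1$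 put $\chi_0(a)=a$, $\chi_{n+1}(a)=a-\mathrm{CBHD}\bigl(\tilde P(\chi_n(a)),P(\chi_n(a))\bigr)$ and $\chi(a)=\lim_n\chi_n(a)$. Then $\exp$ and $\mathrm{CBHD}$ converge on $\mathrm{Hom}(H,A)^1$, $\log$ converges on $\eta_A+\mathrm{Hom}(H,A)^1$, the limit $\chi(a)\in\mathrm{Hom}(H,A)^1$ exists, and for every $\phi\in G_H(A)$ the following holds. 1. $\phi\in\eta_A+\mathrm{Hom}(H,A)^1$, and $Z:=\log\phi$ lies in $g_H(A)$ and in $\mathrm{Hom}(H,A)^1$. 2. There are convolution-invertible $\phi_-,\phi_+\in\mathrm{Hom}(H,A)$ with $$\phi=\phi_-^{-1}*\phi_+,\qquad \phi_-^{-1}=\exp\bigl(\tilde P(\chi(Z))\bigr),\qquad \phi_+=\exp\bigl(P(\chi(Z))\bigr).$$ 3. If moreover $P(g_H(A))\subseteq g_H(A)$, then $\chi(Z)\in g_H(A)$, and $\phi_-$, $\phi_-^{-1}$ and $\phi_+$ are characters. 4. If $P$ is idempotent, the factorization is unique: if $\phi=x*y$ with $x\in\exp\bigl(\tilde P(\mathrm{Hom}(H,A)^1)\bigr)$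 and $y\in\exp\bigl(P(\mathrm{Hom}(H,A)^1)\bigr)$, then $x=\phi_-^{-1}$ and $y=\phi_+$. -/

import Mathlib

open scoped TensorProduct
open Filter

noncomputable section

namespace HopfFactorization

section Graded

variable {k H : Type*} [Field k] [CommRing H] [HopfAlgebra k H]

/-- A Hopf algebra with an algebra grading `𝒜` (given by a `GradedAlgebra 𝒜` instance) is a
connected graded Hopf algebra if comultiplication and counit respect the grading and the scalars
are the only elements of degree zero. (The antipode then respects the grading automatically.) -/
structure IsConnectedGraded (𝒜 : ℕ → Submodule k H) : Prop where
  comul_mem : ∀ n, ∀ h ∈ 𝒜 n, Coalgebra.comul (R := k) h ∈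
    ⨆ p ∈ Finset.HasAntidiagonal.antidiagonal n,
      LinearMap.range (TensorProduct.map (𝒜 p.1).subtype (𝒜 p.2).subtype)
  counit_eq_zero : ∀ n, 0 < n → ∀ h ∈ 𝒜 n, Coalgebra.counit (R := k) h = 0
  connected : 𝒜 0 = LinearMap.range (Algebra.linearMap k H)

end Graded

/-- `Hom(H, A)`: the `k`-linear maps `H → A`, with the convolution product as multiplication and
`h ↦ ε(h) 1` as unit. -/
abbrev ConvHom (k H A : Type*) [Field k] [CommRing H] [HopfAlgebra k H] [CommRing A]
    [Algebra k A] : Type _ := WithConv (H →ₗ[k] A)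

section Bch

variable (k : Type*) {B : Type*} [Field k] [Ring B] [Algebra k B]

/-- The power series `e^{t x} = ∑ xⁿ tⁿ / n!` with coefficients in the (noncommutative)
algebra `B`; the formal variable `t` is central. -/
def expSeries (x : B) : PowerSeries B :=
  PowerSeries.mk fun n => ((n.factorial : k)⁻¹) • x ^ n

/-- The homogeneous component `Φ_m(x, y)` of degree `m` of `log (e^x e^y)`, that is, the
coefficient of `t^m` in `log (e^{t x} e^{t y})`. As `e^{t x} e^{t y} - 1` has no constant term, only
the powers `j ≤ m` in the series of the logarithm contribute. -/
def bchTerm (m : ℕ) (x y : B) : B :=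
  ∑ j ∈ Finset.Icc 1 m, ((-1 : k) ^ (j - 1) / (j : k)) •
    PowerSeries.coeff m ((expSeries k x * expSeries k y - 1) ^ j)

end Bch

section Conv

variable {k H A : Type*} [Field k] [CommRing H] [HopfAlgebra k H] [CommRing A] [Algebra k A]

/-- The decreasing filtration of `Hom(H, A)`: the `n`-th piece consists of the linear maps that
vanish on all homogeneous elements of degree `< n`. -/
def fil (𝒜 : ℕ → Submodule k H) (n : ℕ) : Submodule k (ConvHom k H A) where
  carrier := {f | ∀ m < n, ∀ h ∈ 𝒜 m, f h = 0}
  add_mem' := by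
    intro f g hf hg m hm h hh
    have h1 := hf m hm h hh
    have h2 := hg m hm h hh
    simp_all
  zero_mem' := by
    intro m _ h _
    simp
  smul_mem' := by
    intro c f hf m hm h hh
    have h1 := hf m hm h hh
    simp_all

/-- Convergence of a sequence in the topology given by the filtration. -/
def FilTendsto (𝒜 : ℕ → Submodule k H) (u : ℕ → ConvHom k H A) (f : ConvHom k H A) : Prop :=
  ∀ N, ∀ᶠ n in atTop, u n - f ∈ fil 𝒜 N

/-- The limit in the topology given by the filtration (a junk value if there is none). -/
def filLim (𝒜 : ℕ → Submodule k H) (u : ℕ → ConvHom k H A) : ConvHom k H A :=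
  Classical.epsilon fun f => FilTendsto 𝒜 u f

/-- `f` is the sum of the series `∑ u n` in the topology given by the filtration. -/
def FilHasSum (𝒜 : ℕ → Submodule k H) (u : ℕ → ConvHom k H A) (f : ConvHom k H A) : Prop :=
  FilTendsto 𝒜 (fun N => ∑ n ∈ Finset.range N, u n) f

/-- The sum of a series in the topology given by the filtration. -/
def filSum (𝒜 : ℕ → Submodule k H) (u : ℕ → ConvHom k H A) : ConvHom k H A :=
  filLim 𝒜 fun N => ∑ n ∈ Finset.range N, u n

/-- The `n`-th term of the convolution exponential series. -/
def expTerm (f : ConvHom k H A) (n : ℕ) : ConvHom k H A :=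
  ((n.factorial : k)⁻¹) • f ^ n

/-- The term of degree `n + 1` of the convolution logarithm series. -/
def logTerm (g : ConvHom k H A) (n : ℕ) : ConvHom k H A :=
  ((-1 : k) ^ n / ((n + 1 : ℕ) : k)) • (g - 1) ^ (n + 1)

/-- The convolution exponential `exp f = ∑_{n ≥ 0} fⁿ / n!`. -/
def convExp (𝒜 : ℕ → Submodule k H) (f : ConvHom k H A) : ConvHom k H A :=
  filSum 𝒜 (expTerm f)

/-- The convolution logarithm `log g = ∑_{n ≥ 1} (-1)^(n-1) (g - 1)ⁿ / n`. -/
def convLog (𝒜 : ℕ → Submodule k H) (g : ConvHom k H A) : ConvHom k H A :=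
  filSum 𝒜 (logTerm g)

/-- The Campbell--Baker--Hausdorff--Dynkin series `CBHD(x, y) = ∑_{m ≥ 2} Φ_m(x, y)`. -/
def cbhd (𝒜 : ℕ → Submodule k H) (x y : ConvHom k H A) : ConvHom k H A :=
  filSum 𝒜 fun m => bchTerm k (m + 2) x y

/-- The complementary map `P̃ = id - P`. -/
def tilde (P : ConvHom k H A →ₗ[k] ConvHom k H A) : ConvHom k H A →ₗ[k] ConvHom k H A :=
  LinearMap.id - P

/-- The CBHD recursion of weight one for `P`, with `P̃ = id - P`:
`χ₀(a) = a` and `χₙ₊₁(a) = a - CBHD(P̃(χₙ(a)), P(χₙ(a)))`. -/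
def chiIter (𝒜 : ℕ → Submodule k H) (P : ConvHom k H A →ₗ[k] ConvHom k H A)
    (a : ConvHom k H A) : ℕ → ConvHom k H A
  | 0 => a
  | n + 1 => a - cbhd 𝒜 (tilde P (chiIter 𝒜 P a n)) (P (chiIter 𝒜 P a n))

/-- The map `χ = lim χₙ` of weight one. -/
def chi (𝒜 : ℕ → Submodule k H) (P : ConvHom k H A →ₗ[k] ConvHom k H A)
    (a : ConvHom k H A) : ConvHom k H A :=
  filLim 𝒜 (chiIter 𝒜 P a)

variable (k H A) in
/-- The characters `G_H(A)`: the algebra homomorphisms `H → A`, with the convolution product. -/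
abbrev Character : Type _ := WithConv (H →ₐ[k] A)

/-- A character, viewed as an element of `Hom(H, A)`. -/
def Character.toHom (φ : Character k H A) : ConvHom k H A :=
  WithConv.toConv φ.ofConv.toLinearMap

variable (k H A) in
/-- The space `g_H(A)` of infinitesimal characters: `L(cd) = ε(c) L(d) + ε(d) L(c)`. -/
def infChar : Submodule k (ConvHom k H A) where
  carrier := {L | ∀ c d : H, L (c * d) =
    Coalgebra.counit (R := k) c • L d + Coalgebra.counit (R := k) d • L c}
  add_mem' := by
    intro f g hf hg c d
    have h1 := hf c d
    have h2 := hg c d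
    simp only [WithConv.ofConv_add, LinearMap.add_apply, smul_add, h1, h2]
    abel
  zero_mem' := by
    intro c d
    simp
  smul_mem' := by
    intro r f hf c d
    have h1 := hf c d
    simp only [WithConv.ofConv_smul, LinearMap.smul_apply, h1, smul_add]
    rw [smul_comm r, smul_comm r]

end Conv

end HopfFactorization

end

open HopfFactorization

/-! The exponential turns the factorization into a fixed point equation. Since `exp x * exp y = exp
(x + y + CBHD(x, y))`, any `X` with `X = Z - CBHD(P̃ X, P X)` satisfies `exp (P̃ X) * exp (P X) =
exp Z = φ`, because `P̃ X + P X = X`. All terms of CBHD have degree at least two, so inputs that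
agree modulo step `s + 1` of the filtration give values that agree modulo step `s + 2`
(`IsBch.sub_mem`). The recursion is therefore a contraction, and `χ(Z)` is its unique fixed point
(`chi_eq`, `fixedPoint_unique`). For idempotent `P`, a factorization by `P̃ a` and `P b` yields the
fixed point `P̃ a + P b`, hence uniqueness.

The identities for `exp`, `log` and CBHD are proved for formal power series and then evaluated at
`1` in a complete filtered algebra (`HasEval.mul`, `HasEval.converges_comp`).

For characters, `exp (n L) = (exp L) ^ n` is, on each element of `H`, a polynomial in `n`. The
binomial formula for `L ^ n` makes `exp L` multiplicative if `L` is infinitesimal; conversely, if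
`exp L` is a character, comparing linear coefficients in `n` makes `L` infinitesimal. Thus CBHD
preserves infinitesimal characters because a convolution product of characters is a character; no
Lie polynomials are needed. -/

namespace HopfFactorization

noncomputable section

open PowerSeries

/-! ### Formal logarithm and exponential over a field of characteristic zero. -/

section LogExp

variable {k : Type*} [Field k] [CharZero k]

theorem log_subst_exp_sub_one : (log k).subst (exp k - 1) = (X : k⟦X⟧) := by
  have hs : HasSubst (exp k - 1) := HasSubst.exp_sub_one
  have hg : (mk fun n ↦ algebraMap ℚ k ((-1 : ℚ) ^ n)) * (1 + X) = (1 : k⟦X⟧) := by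
    ext n
    cases n <;> simp [mul_add, coeff_succ_mul_X, coeff_one, pow_succ]
  apply derivative.ext
  · rw [derivative_subst hs, deriv_log]
    have h := congrArg (fun p : k⟦X⟧ => p.subst (exp k - 1)) hg
    simp only [subst_mul hs, subst_add hs, subst_X hs] at h
    have h1 : (1 : k⟦X⟧).subst (exp k - 1) = (1 : k⟦X⟧) := by
      rw [← coe_substAlgHom hs, map_one]
    rw [h1, add_sub_cancel] at h
    simpa [derivative_exp] using h
  · rw [constantCoeff_X]
    exact constantCoeff_subst_eq_zero (by simp [← constantCoeff_eq]) _ (by simp)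

theorem exp_subst_log : (exp k).subst (log k) = (1 + X : k⟦X⟧) := by
  have hs : HasSubst (log k) := HasSubst.log
  set g : k⟦X⟧ := mk fun n ↦ algebraMap ℚ k ((-1 : ℚ) ^ n) with hgdef
  have hg : g * (1 + X) = (1 : k⟦X⟧) := by
    ext n
    cases n <;> simp [hgdef, mul_add, coeff_succ_mul_X, coeff_one, pow_succ]
  have hW : d⁄dX k ((exp k).subst (log k)) = (exp k).subst (log k) * g := by
    rw [derivative_subst hs, deriv_log, derivative_exp]
  have hg' : d⁄dX k g = - (g * g) := by
    have h := congrArg (d⁄dX k) hg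
    simp only [Derivation.leibniz, map_add, derivative_X, Derivation.map_one_eq_zero,
      smul_eq_mul] at h
    linear_combination g * h - (d⁄dX k g) * hg
  -- With `W = exp (log)` and `g = 1 / (1 + X)`, the rules `W' = W g` and `g' = -g²` give `(W g)' =
  -- 0`.
  have hWg : (exp k).subst (log k) * g = (1 : k⟦X⟧) := by
    apply derivative.ext
    · simp only [Derivation.leibniz, hW, hg', smul_eq_mul, Derivation.map_one_eq_zero]
      ring
    · have h0 : constantCoeff ((exp k).subst (log k) : k⟦X⟧) = 1 := by
        have : (exp k).subst (log k) = (exp k - 1).subst (log k) + (1 : k⟦X⟧) := by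
          rw [subst_sub hs, ← coe_substAlgHom hs, map_one]
          ring
        rw [this, map_add, show constantCoeff ((exp k - 1).subst (log k) : k⟦X⟧) = 0 from
          constantCoeff_subst_eq_zero (by simp [← constantCoeff_eq]) _ (by simp)]
        simp
      rw [map_mul, h0]
      simp [hgdef, ← coeff_zero_eq_constantCoeff_apply]
  linear_combination (1 + X : k⟦X⟧) * hWg - (exp k).subst (log k) * hg

end LogExp

/-! ### Scalar power series evaluated at series over a noncommutative algebra. -/

section Comp

variable {k B : Type*} [Field k] [Ring B] [Algebra k B]

/-- Substitution of a power series without constant term over a (noncommutative) algebra into a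
scalar power series. -/
def comp (p : k⟦X⟧) (G : B⟦X⟧) : B⟦X⟧ :=
  mk fun m => ∑ j ∈ Finset.range (m + 1), coeff j p • coeff m (G ^ j)

/-- The substitution `X ↦ z X` into scalar power series. -/
def scaleHom (z : B) : k⟦X⟧ →+* B⟦X⟧ where
  toFun p := mk fun n => coeff n p • z ^ n
  map_one' := by
    ext n
    by_cases h : n = 0 <;> simp [coeff_one, h]
  map_zero' := by ext n; simp
  map_add' p q := by ext n; simp [add_smul]
  map_mul' p q := by
    ext n
    simp only [coeff_mk, coeff_mul, Finset.sum_smul]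
    refine Finset.sum_congr rfl fun i hi => ?_
    rw [smul_mul_smul_comm, ← pow_add, Finset.HasAntidiagonal.mem_antidiagonal.mp hi]

@[simp]
theorem coeff_scaleHom (z : B) (p : k⟦X⟧) (n : ℕ) :
    coeff n (scaleHom z p) = coeff n p • z ^ n := by
  simp [scaleHom]

/-- Makes the truncation at `j ≤ m` in `comp` harmless. -/
theorem coeff_pow_eq_zero {G : B⟦X⟧} (hG : coeff 0 G = 0) {m j : ℕ} (h : m < j) :
    coeff m (G ^ j) = 0 := by
  induction j generalizing m with
  | zero => omega
  | succ j ih =>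
    rw [pow_succ, coeff_mul]
    refine Finset.sum_eq_zero fun i hi => ?_
    rw [Finset.HasAntidiagonal.mem_antidiagonal] at hi
    by_cases h2 : i.2 = 0
    · rw [h2, hG, mul_zero]
    · rw [ih (by omega), zero_mul]

theorem comp_eq_subst {p q : k⟦X⟧} (hq : coeff 0 q = 0) : comp p q = p.subst q := by
  have hs : HasSubst q := HasSubst.of_constantCoeff_zero' (by simpa using hq)
  ext m
  rw [coeff_subst' hs, comp, coeff_mk, finsum_eq_sum_of_support_subset]
  intro j hj
  simp only [Function.mem_support, Finset.coe_range, Set.mem_Iio] at hj ⊢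
  by_contra h
  exact hj (by rw [coeff_pow_eq_zero hq (by omega), smul_zero])

/-- Powers of a single `z` commute, so `scaleHom z` is multiplicative and carries scalar identities
over to `B`. -/
theorem scaleHom_comp (z : B) (p q : k⟦X⟧) : scaleHom z (comp p q) = comp p (scaleHom z q) := by
  ext m
  simp only [coeff_scaleHom, comp, coeff_mk, Finset.sum_smul, ← map_pow, smul_assoc]

theorem expSeries_eq_scaleHom [CharZero k] (z : B) : expSeries k z = scaleHom z (exp k) := by
  ext n
  simp [expSeries]

theorem comp_log_expSeries_sub_one [CharZero k] (z : B) :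
    comp (log k) (expSeries k z - 1) = scaleHom z (X : k⟦X⟧) := by
  rw [expSeries_eq_scaleHom, ← map_one (scaleHom (k := k) z), ← map_sub, ← scaleHom_comp,
    comp_eq_subst (by simp), log_subst_exp_sub_one]

theorem comp_exp_scaleHom_log [CharZero k] (z : B) :
    comp (exp k) (scaleHom z (log k)) = scaleHom z (1 + X : k⟦X⟧) := by
  rw [← scaleHom_comp, comp_eq_subst (by simp), exp_subst_log]

theorem expSeries_nsmul [CharZero k] (z : B) (n : ℕ) :
    expSeries k (n • z) = expSeries k z ^ n := by
  simp only [expSeries_eq_scaleHom, ← map_pow, exp_pow_eq_rescale_exp]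
  ext m
  rw [coeff_scaleHom, coeff_scaleHom, coeff_rescale, smul_pow, mul_comm, mul_smul,
    ← Nat.cast_smul_eq_nsmul k, Nat.cast_pow]

theorem expSeries_mul_expSeries_neg [CharZero k] (z : B) :
    expSeries k z * expSeries k (-z) = 1 := by
  have h : expSeries k (-z) = scaleHom z (evalNegHom (exp k)) := by
    ext m
    rw [expSeries_eq_scaleHom, coeff_scaleHom, coeff_scaleHom, evalNegHom, coeff_rescale, mul_comm,
      mul_smul, neg_pow z, Algebra.smul_def ((-1 : k) ^ m)]
    simp
  rw [h, expSeries_eq_scaleHom, ← map_mul, exp_mul_exp_neg_eq_one, map_one]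

theorem bchTerm_eq_coeff_comp [CharZero k] (m : ℕ) (x y : B) :
    bchTerm k m x y = coeff m (comp (log k) (expSeries k x * expSeries k y - 1)) := by
  rw [bchTerm, comp, coeff_mk, Finset.sum_range_succ', Finset.range_eq_Ico,
    Finset.sum_Ico_add' (fun j => coeff j (log k) •
      coeff m ((expSeries k x * expSeries k y - 1) ^ j)) 0 m 1]
  simp only [coeff_log, if_true, zero_smul, add_zero, zero_add]
  refine Finset.sum_congr (by ext; simp) fun j hj => ?_
  obtain ⟨i, rfl⟩ : ∃ i, j = i + 1 := ⟨j - 1, by simp at hj; omega⟩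
  simp [pow_succ]

end Comp

end

/-! ### Complete filtrations and evaluation of power series at `1`. -/

noncomputable section

open PowerSeries

variable {k B : Type*} [Field k] [Ring B] [Algebra k B] {F : ℕ → Submodule k B}

/-- A complete and separated decreasing multiplicative filtration of an algebra, starting with the
whole algebra. -/
structure IsCompleteFiltration (F : ℕ → Submodule k B) : Prop where
  antitone : Antitone F
  zero_eq_top : F 0 = ⊤
  mul_mem : ∀ {m n x y}, x ∈ F m → y ∈ F n → x * y ∈ F (m + n)
  separated : ∀ x, (∀ n, x ∈ F n) → x = 0
  complete : ∀ u : ℕ → B, (∀ N, ∀ᶠ n in atTop, u (n + 1) - u n ∈ F N) →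
    ∃ f, ∀ N, ∀ᶠ n in atTop, u n - f ∈ F N

/-- Convergence of a sequence in the topology given by a filtration. -/
def Converges (F : ℕ → Submodule k B) (u : ℕ → B) (f : B) : Prop :=
  ∀ N, ∀ᶠ n in atTop, u n - f ∈ F N

/-- `f` is the value at `1` of the power series `G`, all of whose partial sums are correct up to
the error that the filtration allows. -/
def HasEval (F : ℕ → Submodule k B) (G : B⟦X⟧) (f : B) : Prop :=
  ∀ M, ∑ n ∈ Finset.range M, coeff n G - f ∈ F M

/-- The `n`-th coefficient of `G` lies in step `n + s` of the filtration. -/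
def Adic (F : ℕ → Submodule k B) (s : ℕ) (G : B⟦X⟧) : Prop :=
  ∀ n, coeff n G ∈ F (n + s)

theorem Converges.mem {u : ℕ → B} {f : B} {N : ℕ} (h : Converges F u f)
    (hu : ∀ᶠ n in atTop, u n ∈ F N) : f ∈ F N := by
  obtain ⟨n, h1, h2⟩ := ((h N).and hu).exists
  simpa using (F N).sub_mem h2 h1

/-- The reason why `HasEval` prescribes a rate: subtracting consecutive partial sums bounds each
coefficient, which plain convergence would not. -/
theorem HasEval.coeff_mem {G : B⟦X⟧} {f : B} (h : HasEval F G f)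
    (hF : IsCompleteFiltration F) : Adic F 0 G := by
  intro n
  have := (F n).sub_mem (hF.antitone n.le_succ (h (n + 1))) (h n)
  rw [Finset.sum_range_succ] at this
  simpa [add_sub_right_comm] using this

theorem HasEval.converges {G : B⟦X⟧} {f : B} (h : HasEval F G f) (hF : IsCompleteFiltration F) :
    Converges F (fun N => ∑ n ∈ Finset.range N, coeff n G) f := fun N => by
  filter_upwards [eventually_ge_atTop N] with n hn
  exact hF.antitone hn (h n)

namespace IsCompleteFiltration

theorem mem_zero (hF : IsCompleteFiltration F) (x : B) : x ∈ F 0 := by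
  rw [hF.zero_eq_top]; trivial

theorem mul_mem_left (hF : IsCompleteFiltration F) {n : ℕ} (x : B) {y : B} (hy : y ∈ F n) :
    x * y ∈ F n := by
  simpa using hF.mul_mem (hF.mem_zero x) hy

theorem mul_mem_right (hF : IsCompleteFiltration F) {n : ℕ} {x : B} (hx : x ∈ F n) (y : B) :
    x * y ∈ F n := by
  simpa using hF.mul_mem hx (hF.mem_zero y)

theorem pow_mem (hF : IsCompleteFiltration F) {m : ℕ} {x : B} (hx : x ∈ F m) (n : ℕ) :
    x ^ n ∈ F (n * m) := by
  induction n with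
  | zero => simpa using hF.mem_zero 1
  | succ n ih => rw [pow_succ, Nat.succ_mul]; exact hF.mul_mem ih hx

theorem pow_mem_of_mem_one (hF : IsCompleteFiltration F) {x : B} (hx : x ∈ F 1) (n : ℕ) :
    x ^ n ∈ F n := by
  simpa using hF.pow_mem hx n

theorem eq_of_sub_mem (hF : IsCompleteFiltration F) {x y : B} (h : ∀ n, x - y ∈ F n) : x = y :=
  sub_eq_zero.mp (hF.separated _ h)

theorem unique (hF : IsCompleteFiltration F) {u : ℕ → B} {f g : B} (hf : Converges F u f)
    (hg : Converges F u g) : f = g := by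
  refine hF.eq_of_sub_mem fun N => ?_
  obtain ⟨n, h1, h2⟩ := ((hf N).and (hg N)).exists
  simpa using (F N).sub_mem h2 h1

theorem exists_hasEval (hF : IsCompleteFiltration F) {G : B⟦X⟧} (hG : Adic F 0 G) :
    ∃ f, HasEval F G f := by
  obtain ⟨f, hf⟩ := hF.complete (fun N => ∑ n ∈ Finset.range N, coeff n G) fun N => by
    filter_upwards [eventually_ge_atTop N] with n hn
    rw [Finset.sum_range_succ, add_sub_cancel_left]
    exact hF.antitone (by omega) (hG n)
  refine ⟨f, fun M => ?_⟩
  obtain ⟨n, h1, h2⟩ := ((hf M).and (eventually_ge_atTop M)).exists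
  rw [← Finset.sum_range_add_sum_Ico _ h2] at h1
  have h3 : ∑ i ∈ Finset.Ico M n, coeff i G ∈ F M :=
    (F M).sum_mem fun i hi => hF.antitone (by simp at hi; omega) (hG i)
  convert (F M).sub_mem h1 h3 using 1
  abel

end IsCompleteFiltration

theorem HasEval.unique {G : B⟦X⟧} {f g : B} (hf : HasEval F G f) (hg : HasEval F G g)
    (hF : IsCompleteFiltration F) : f = g :=
  hF.unique (hf.converges hF) (hg.converges hF)

theorem HasEval.add {G G' : B⟦X⟧} {f f' : B} (h : HasEval F G f) (h' : HasEval F G' f') :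
    HasEval F (G + G') (f + f') := fun M => by
  simp only [map_add, Finset.sum_add_distrib, add_sub_add_comm]
  exact (F M).add_mem (h M) (h' M)

theorem HasEval.neg {G : B⟦X⟧} {f : B} (h : HasEval F G f) : HasEval F (-G) (-f) := fun M => by
  have := (F M).neg_mem (h M)
  rwa [neg_sub, ← neg_sub_neg, ← Finset.sum_neg_distrib] at this

theorem HasEval.sub {G G' : B⟦X⟧} {f f' : B} (h : HasEval F G f) (h' : HasEval F G' f') :
    HasEval F (G - G') (f - f') := by
  simpa only [sub_eq_add_neg] using h.add h'.neg

theorem hasEval_monomial (hF : IsCompleteFiltration F) {n : ℕ} {b : B} (hb : b ∈ F n) :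
    HasEval F (monomial n b) b := fun M => by
  simp only [coeff_monomial, Finset.sum_ite_eq', Finset.mem_range]
  split_ifs with h
  · simp
  · simpa using hF.antitone (not_lt.mp h) hb

theorem hasEval_one (hF : IsCompleteFiltration F) : HasEval F (1 : B⟦X⟧) 1 := by
  have h := hasEval_monomial (n := 0) hF (hF.mem_zero 1)
  rwa [monomial_zero_eq_C_apply, map_one] at h

theorem HasEval.mul {G G' : B⟦X⟧} {f f' : B} (h : HasEval F G f) (h' : HasEval F G' f')
    (hF : IsCompleteFiltration F) : HasEval F (G * G') (f * f') := fun M => by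
  -- The product of the partial sums runs over a square. The triangle below the antidiagonal is the
  -- partial sum of the Cauchy product; the other terms lie in `F M`.
  have key : ∑ n ∈ Finset.range M, coeff n (G * G') =
      ∑ p ∈ (Finset.range M ×ˢ Finset.range M) with p.1 + p.2 < M,
        coeff p.1 G * coeff p.2 G' := by
    simp only [coeff_mul]
    rw [Finset.sum_sigma']
    refine Finset.sum_nbij' (fun s => s.2) (fun p => ⟨p.1 + p.2, p⟩) ?_ ?_ ?_ ?_ ?_
    · rintro ⟨n, p⟩ hp
      simp only [Finset.mem_sigma, Finset.mem_range, Finset.HasAntidiagonal.mem_antidiagonal,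
        Finset.mem_filter, Finset.mem_product] at hp ⊢
      omega
    · rintro p hp
      simp only [Finset.mem_sigma, Finset.mem_range, Finset.HasAntidiagonal.mem_antidiagonal,
        Finset.mem_filter, Finset.mem_product] at hp ⊢
      exact ⟨hp.2, trivial⟩
    · rintro ⟨n, p⟩ hp
      simp only [Finset.mem_sigma, Finset.mem_range, Finset.HasAntidiagonal.mem_antidiagonal] at hp
      obtain ⟨-, rfl⟩ := hp
      rfl
    · intros; rfl
    · intros; rfl
  have hprod : (∑ n ∈ Finset.range M, coeff n G) * (∑ n ∈ Finset.range M, coeff n G') =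
      ∑ n ∈ Finset.range M, coeff n (G * G') +
      ∑ p ∈ (Finset.range M ×ˢ Finset.range M) with ¬ p.1 + p.2 < M,
        coeff p.1 G * coeff p.2 G' := by
    rw [key, Finset.sum_filter_add_sum_filter_not, Finset.sum_mul_sum, Finset.sum_product]
  have hrest : ∑ p ∈ (Finset.range M ×ˢ Finset.range M) with ¬ p.1 + p.2 < M,
      coeff p.1 G * coeff p.2 G' ∈ F M := by
    refine (F M).sum_mem fun p hp => ?_
    simp only [Finset.mem_filter] at hp
    exact hF.antitone (by omega : M ≤ p.1 + 0 + (p.2 + 0))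
      (hF.mul_mem (h.coeff_mem hF _) (h'.coeff_mem hF _))
  have e1 := hF.mul_mem_right (h M) (∑ n ∈ Finset.range M, coeff n G')
  have e2 := hF.mul_mem_left f (h' M)
  rw [sub_mul, hprod] at e1
  rw [mul_sub] at e2
  convert (F M).sub_mem ((F M).add_mem e1 e2) hrest using 1
  abel

theorem HasEval.pow {G : B⟦X⟧} {f : B} (h : HasEval F G f) (hF : IsCompleteFiltration F) (n : ℕ) :
    HasEval F (G ^ n) (f ^ n) := by
  induction n with
  | zero => simpa using hasEval_one hF
  | succ n ih => simpa only [pow_succ] using ih.mul h hF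

theorem HasEval.mem_one {G : B⟦X⟧} {f : B} (h : HasEval F G f) (hG : coeff 0 G = 0) :
    f ∈ F 1 := by
  have := h 1
  rw [Finset.sum_range_one, hG, zero_sub] at this
  simpa using (F 1).neg_mem this

/-- Evaluation at `1` commutes with substitution into scalar power series. -/
theorem HasEval.converges_comp {p : k⟦X⟧} {G : B⟦X⟧} {g f : B} (hF : IsCompleteFiltration F)
    (hG : coeff 0 G = 0) (h : HasEval F G g) (hf : HasEval F (comp p G) f) :
    Converges F (fun N => ∑ j ∈ Finset.range N, coeff j p • g ^ j) f := fun N => by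
  filter_upwards [eventually_ge_atTop N] with M hM
  refine hF.antitone hM ?_
  -- The inner sum over `j ≤ m` may be extended to `j < M`, as the added coefficients vanish; then
  -- the two sums are exchanged.
  have h1 : ∑ m ∈ Finset.range M, coeff m (comp p G) =
      ∑ j ∈ Finset.range M, coeff j p • ∑ m ∈ Finset.range M, coeff m (G ^ j) := by
    simp only [Finset.smul_sum]
    rw [Finset.sum_comm]
    refine Finset.sum_congr rfl fun m hm => ?_
    rw [comp, coeff_mk]
    refine Finset.sum_subset (by simp at hm ⊢; omega) fun j _ hj => ?_
    rw [coeff_pow_eq_zero hG (by simpa using hj), smul_zero]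
  have h2 : ∑ j ∈ Finset.range M, coeff j p • (∑ m ∈ Finset.range M, coeff m (G ^ j) - g ^ j) ∈
      F M :=
    (F M).sum_mem fun j _ => (F M).smul_mem _ (h.pow hF j M)
  have h3 := hf M
  rw [h1] at h3
  simp only [smul_sub, Finset.sum_sub_distrib] at h2
  convert (F M).sub_mem h3 h2 using 1
  abel

theorem adic_zero_scaleHom (hF : IsCompleteFiltration F) {z : B} (hz : z ∈ F 1) (p : k⟦X⟧) :
    Adic F 0 (scaleHom z p) := fun n => by
  rw [coeff_scaleHom]
  exact (F n).smul_mem _ (hF.pow_mem_of_mem_one hz n)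

theorem hasEval_scaleHom_X (hF : IsCompleteFiltration F) {z : B} (hz : z ∈ F 1) :
    HasEval F (scaleHom z (X : k⟦X⟧)) z := by
  convert hasEval_monomial hF hz
  ext n
  rw [coeff_scaleHom, coeff_X, coeff_monomial]
  split_ifs with h <;> simp [h]

theorem Adic.add {s : ℕ} {G G' : B⟦X⟧} (h : Adic F s G) (h' : Adic F s G') :
    Adic F s (G + G') := fun n => by
  rw [map_add]
  exact (F _).add_mem (h n) (h' n)

theorem Adic.mul {s t : ℕ} {G G' : B⟦X⟧} (h : Adic F s G) (h' : Adic F t G')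
    (hF : IsCompleteFiltration F) : Adic F (s + t) (G * G') := fun n => by
  rw [coeff_mul]
  refine (F _).sum_mem fun p hp => ?_
  rw [Finset.HasAntidiagonal.mem_antidiagonal] at hp
  exact hF.antitone (by omega) (hF.mul_mem (h p.1) (h' p.2))

theorem Adic.mul_sub_mul {s : ℕ} {G G' K K' : B⟦X⟧} (hF : IsCompleteFiltration F)
    (hG : Adic F 0 G) (hK' : Adic F 0 K') (h : Adic F s (G - G')) (h' : Adic F s (K - K')) :
    Adic F s (G * K - G' * K') := by
  have h1 : Adic F s (G * (K - K')) := by simpa using hG.mul h' hF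
  have h2 : Adic F s ((G - G') * K') := by simpa using h.mul hK' hF
  convert h1.add h2 using 1
  noncomm_ring

theorem adic_zero_one (hF : IsCompleteFiltration F) : Adic F 0 (1 : B⟦X⟧) :=
  (hasEval_one hF).coeff_mem hF

theorem Adic.pow (hF : IsCompleteFiltration F) {G : B⟦X⟧} (hG : Adic F 0 G) (j : ℕ) :
    Adic F 0 (G ^ j) := by
  induction j with
  | zero => simpa using adic_zero_one hF
  | succ j ih => simpa only [pow_succ] using ih.mul hG hF

theorem Adic.pow_sub_pow {s : ℕ} {G G' : B⟦X⟧} (hF : IsCompleteFiltration F)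
    (hG : Adic F 0 G) (hG' : Adic F 0 G') (h : Adic F s (G - G')) (j : ℕ) :
    Adic F s (G ^ j - G' ^ j) := by
  induction j with
  | zero => intro n; simp
  | succ j ih =>
    simp only [pow_succ]
    exact Adic.mul_sub_mul hF (hG.pow hF j) hG' ih h

theorem Adic.comp (hF : IsCompleteFiltration F) {G : B⟦X⟧} (hG : Adic F 0 G) (p : k⟦X⟧) :
    Adic F 0 (comp p G) := fun n => by
  rw [HopfFactorization.comp, coeff_mk]
  exact (F _).sum_mem fun j _ => (F _).smul_mem _ (hG.pow hF j n)

/-- Telescoping `xⁿ - yⁿ` leaves one factor `x - y` in `F (s + 1)` and `n - 1` factors in `F 1`; the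
constant terms cancel. -/
theorem adic_expSeries_sub (hF : IsCompleteFiltration F) {s : ℕ} {x y : B} (hx : x ∈ F 1)
    (hy : y ∈ F 1) (h : x - y ∈ F (s + 1)) : Adic F s (expSeries k x - expSeries k y) := by
  have key : ∀ n, x ^ (n + 1) - y ^ (n + 1) ∈ F (n + 1 + s) := by
    intro n
    induction n with
    | zero => simpa [add_comm 1 s] using h
    | succ n ih =>
      have h1 := hF.mul_mem (hF.pow_mem_of_mem_one hx (n + 1)) h
      have h2 := hF.mul_mem ih hy
      rw [show n + 1 + (s + 1) = n + 1 + 1 + s by omega] at h1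
      rw [show n + 1 + s + 1 = n + 1 + 1 + s by omega] at h2
      convert (F _).add_mem h1 h2 using 1
      rw [pow_succ x (n + 1), pow_succ y (n + 1)]
      noncomm_ring
  intro n
  rw [map_sub, expSeries, expSeries, coeff_mk, coeff_mk, ← smul_sub]
  cases n with
  | zero => simp
  | succ n => exact (F _).smul_mem _ (key n)

/-! ### Exponential, logarithm and CBHD series in a complete filtered algebra. -/

/-- `e` is the sum of the exponential series at `x`. -/
def IsExp (F : ℕ → Submodule k B) (x e : B) : Prop :=
  Converges F (fun N => ∑ n ∈ Finset.range N, ((n.factorial : k)⁻¹) • x ^ n) e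

/-- `l` is the sum of the logarithm series at `g`. -/
def IsLog (F : ℕ → Submodule k B) (g l : B) : Prop :=
  Converges F (fun N => ∑ n ∈ Finset.range N,
    ((-1 : k) ^ n / ((n + 1 : ℕ) : k)) • (g - 1) ^ (n + 1)) l

/-- `c` is the sum of the terms of degree at least two of the Campbell--Baker--Hausdorff series. -/
def IsBch (F : ℕ → Submodule k B) (x y c : B) : Prop :=
  Converges F (fun N => ∑ n ∈ Finset.range N, bchTerm k (n + 2) x y) c

theorem constantCoeff_expSeries (x : B) : constantCoeff (expSeries k x) = 1 := by
  simp [← coeff_zero_eq_constantCoeff_apply, expSeries]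

theorem bchTerm_zero (x y : B) : bchTerm k 0 x y = 0 := by
  simp [bchTerm]

theorem bchTerm_one (x y : B) : bchTerm k 1 x y = x + y := by
  simp [bchTerm, coeff_mul, expSeries, coeff_one, Finset.Nat.antidiagonal_succ, add_comm]

section ExpLog

variable [CharZero k]

theorem adic_zero_expSeries (hF : IsCompleteFiltration F) {x : B} (hx : x ∈ F 1) :
    Adic F 0 (expSeries k x) := by
  rw [expSeries_eq_scaleHom]
  exact adic_zero_scaleHom hF hx _

theorem isExp_iff (hF : IsCompleteFiltration F) {x e : B} (hx : x ∈ F 1) :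
    IsExp F x e ↔ HasEval F (expSeries k x) e := by
  have h : ∀ {e}, HasEval F (expSeries k x) e → IsExp F x e := fun he => by
    simpa only [IsExp, expSeries, coeff_mk] using he.converges hF
  refine ⟨fun he => ?_, h⟩
  obtain ⟨f, hf⟩ := hF.exists_hasEval (adic_zero_expSeries hF hx)
  rwa [hF.unique he (h hf)]

theorem exists_isExp (hF : IsCompleteFiltration F) {x : B} (hx : x ∈ F 1) : ∃ e, IsExp F x e := by
  obtain ⟨f, hf⟩ := hF.exists_hasEval (adic_zero_expSeries hF hx)
  exact ⟨f, (isExp_iff hF hx).mpr hf⟩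

theorem IsExp.sub_one_mem (hF : IsCompleteFiltration F) {x e : B} (hx : x ∈ F 1)
    (h : IsExp F x e) : e - 1 ∈ F 1 :=
  (((isExp_iff hF hx).mp h).sub (hasEval_one hF)).mem_one (by simp [constantCoeff_expSeries])

theorem isLog_of_hasEval_comp (hF : IsCompleteFiltration F) {G : B⟦X⟧} {g l : B}
    (hG : coeff 0 G = 0) (h : HasEval F G (g - 1)) (hl : HasEval F (comp (log k) G) l) :
    IsLog F g l := by
  intro N
  -- `IsLog` starts with the first power, hence the shift by one past the zero constant term of
  -- `log`.
  filter_upwards [(tendsto_add_atTop_nat 1).eventually (h.converges_comp hF hG hl N)] with n hn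
  rw [Finset.sum_range_succ'] at hn
  simpa [pow_succ (-1 : k)] using hn

theorem isLog_of_isExp (hF : IsCompleteFiltration F) {x e : B} (hx : x ∈ F 1)
    (h : IsExp F x e) : IsLog F e x := by
  refine isLog_of_hasEval_comp hF (G := expSeries k x - 1) (by simp [constantCoeff_expSeries])
    (((isExp_iff hF hx).mp h).sub (hasEval_one hF)) ?_
  rw [comp_log_expSeries_sub_one]
  exact hasEval_scaleHom_X hF hx

/-- The value of `log` at `g - 1` exponentiates to `g` because `exp (log) = 1 + X` formally. -/
theorem exists_isLog (hF : IsCompleteFiltration F) {g : B} (hg : g - 1 ∈ F 1) :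
    ∃ l ∈ F 1, IsLog F g l ∧ IsExp F l g := by
  obtain ⟨l, hl⟩ := hF.exists_hasEval (adic_zero_scaleHom hF hg (log k))
  have h0 : coeff 0 (scaleHom (g - 1) (log k)) = 0 := by simp
  have hl1 := hl.mem_one h0
  refine ⟨l, hl1, ?_, ?_⟩
  · refine isLog_of_hasEval_comp hF (G := scaleHom (g - 1) (X : k⟦X⟧)) (by simp)
      (hasEval_scaleHom_X hF hg) ?_
    rwa [← scaleHom_comp, comp_eq_subst (by simp), ← map_algebraMap_eq_subst_X]
  · have h1 : HasEval F (scaleHom (g - 1) (1 + X : k⟦X⟧)) g := by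
      simpa using (hasEval_one hF).add (hasEval_scaleHom_X (k := k) hF hg)
    rw [← comp_exp_scaleHom_log] at h1
    simpa [IsExp] using hl.converges_comp hF h0 h1

theorem IsLog.mem_one (hF : IsCompleteFiltration F) {g l : B} (hg : g - 1 ∈ F 1)
    (h : IsLog F g l) : l ∈ F 1 := by
  obtain ⟨l', h1, h2, -⟩ := exists_isLog hF hg
  rwa [hF.unique h h2]

theorem IsLog.isExp (hF : IsCompleteFiltration F) {g l : B} (hg : g - 1 ∈ F 1)
    (h : IsLog F g l) : IsExp F l g := by
  obtain ⟨l', -, h2, h3⟩ := exists_isLog hF hg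
  rwa [hF.unique h h2]

theorem IsExp.injective (hF : IsCompleteFiltration F) {x y e : B} (hx : x ∈ F 1) (hy : y ∈ F 1)
    (h : IsExp F x e) (h' : IsExp F y e) : x = y :=
  hF.unique (isLog_of_isExp hF hx h) (isLog_of_isExp hF hy h')

theorem IsExp.nsmul (hF : IsCompleteFiltration F) {x e : B} (hx : x ∈ F 1) (h : IsExp F x e)
    (n : ℕ) : IsExp F (n • x) (e ^ n) := by
  rw [isExp_iff hF ((F 1).nsmul_mem hx n), expSeries_nsmul]
  exact ((isExp_iff hF hx).mp h).pow hF n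

theorem IsExp.mul_neg (hF : IsCompleteFiltration F) {x e e' : B} (hx : x ∈ F 1)
    (h : IsExp F x e) (h' : IsExp F (-x) e') : e * e' = 1 := by
  have h1 := ((isExp_iff hF hx).mp h).mul ((isExp_iff hF ((F 1).neg_mem hx)).mp h') hF
  rw [expSeries_mul_expSeries_neg] at h1
  exact h1.unique (hasEval_one hF) hF

/-- The Campbell--Baker--Hausdorff series is the logarithm of `exp x * exp y`. -/
theorem exists_isBch (hF : IsCompleteFiltration F) {x y e e' : B} (hx : x ∈ F 1) (hy : y ∈ F 1)
    (h : IsExp F x e) (h' : IsExp F y e') : ∃ c, IsBch F x y c ∧ IsLog F (e * e') (x + y + c) := by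
  have hU := (((isExp_iff hF hx).mp h).mul ((isExp_iff hF hy).mp h') hF).sub (hasEval_one hF)
  have hU0 : coeff 0 (expSeries k x * expSeries k y - 1) = 0 := by
    simp [constantCoeff_expSeries]
  obtain ⟨l, hl⟩ := hF.exists_hasEval ((hU.coeff_mem hF).comp hF (log k))
  refine ⟨l - (x + y), fun N => ?_, ?_⟩
  -- The terms of degrees `0` and `1` are `0` and `x + y`; the rest is CBHD.
  · filter_upwards [(tendsto_add_atTop_nat 2).eventually (hl.converges hF N)] with n hn
    simp only [← bchTerm_eq_coeff_comp] at hn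
    rw [Finset.sum_range_succ', Finset.sum_range_succ', bchTerm_zero, bchTerm_one] at hn
    convert hn using 1
    abel
  · rw [add_sub_cancel]
    exact isLog_of_hasEval_comp hF hU0 hU hl

theorem IsBch.isLog (hF : IsCompleteFiltration F) {x y e e' c : B} (hx : x ∈ F 1) (hy : y ∈ F 1)
    (h : IsExp F x e) (h' : IsExp F y e') (hc : IsBch F x y c) :
    IsLog F (e * e') (x + y + c) := by
  obtain ⟨c', h1, h2⟩ := exists_isBch hF hx hy h h'
  rwa [hF.unique hc h1]

theorem bchTerm_sub_mem (hF : IsCompleteFiltration F) {s : ℕ} {x y x' y' : B} (hx : x ∈ F 1)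
    (hy : y ∈ F 1) (hx' : x' ∈ F 1) (hy' : y' ∈ F 1) (h : x - x' ∈ F (s + 1))
    (h' : y - y' ∈ F (s + 1)) (m : ℕ) : bchTerm k m x y - bchTerm k m x' y' ∈ F (m + s) := by
  have hU : ∀ {x y : B}, x ∈ F 1 → y ∈ F 1 → Adic F 0 (expSeries k x * expSeries k y - 1) := by
    intro x y hx hy n
    rw [map_sub]
    exact (F _).sub_mem ((adic_zero_expSeries hF hx).mul (adic_zero_expSeries hF hy) hF n)
      (adic_zero_one hF n)
  have hd : Adic F s ((expSeries k x * expSeries k y - 1) -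
      (expSeries k x' * expSeries k y' - 1)) := by
    rw [sub_sub_sub_cancel_right]
    exact Adic.mul_sub_mul hF (adic_zero_expSeries hF hx) (adic_zero_expSeries hF hy')
      (adic_expSeries_sub hF hx hx' h) (adic_expSeries_sub hF hy hy' h')
  rw [bchTerm, bchTerm, ← Finset.sum_sub_distrib]
  refine (F _).sum_mem fun j _ => ?_
  rw [← smul_sub, ← map_sub]
  exact (F _).smul_mem _ (Adic.pow_sub_pow hF (hU hx hy) (hU hx' hy') hd j m)

/-- The contraction estimate: in degree `m` the difference lies in `F (m + s)`, and CBHD only has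
terms with `m ≥ 2`. -/
theorem IsBch.sub_mem (hF : IsCompleteFiltration F) {s : ℕ} {x y x' y' c c' : B} (hx : x ∈ F 1)
    (hy : y ∈ F 1) (hx' : x' ∈ F 1) (hy' : y' ∈ F 1) (h : x - x' ∈ F (s + 1))
    (h' : y - y' ∈ F (s + 1)) (hc : IsBch F x y c) (hc' : IsBch F x' y' c') :
    c - c' ∈ F (s + 2) := by
  obtain ⟨n, h1, h2⟩ := ((hc (s + 2)).and (hc' (s + 2))).exists
  have h3 : ∑ i ∈ Finset.range n, bchTerm k (i + 2) x y -
      ∑ i ∈ Finset.range n, bchTerm k (i + 2) x' y' ∈ F (s + 2) := by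
    rw [← Finset.sum_sub_distrib]
    exact (F _).sum_mem fun i _ =>
      hF.antitone (by omega) (bchTerm_sub_mem hF hx hy hx' hy' h h' (i + 2))
  convert (F _).add_mem ((F _).sub_mem h3 h1) h2 using 1
  abel

theorem IsBch.mem (hF : IsCompleteFiltration F) {x y c : B} (hx : x ∈ F 1)
    (hy : y ∈ F 1) (hc : IsBch F x y c) : c ∈ F 2 := by
  have h0 : IsBch F (0 : B) 0 0 := by
    obtain ⟨e, he⟩ := exists_isExp hF (F 1).zero_mem
    obtain ⟨c, h1, -⟩ := exists_isBch hF (F 1).zero_mem (F 1).zero_mem he he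
    have h2 : ∀ m, bchTerm k (m + 2) (0 : B) 0 = 0 := fun m => by
      have h3 : expSeries k (0 : B) = 1 := by
        simpa using expSeries_nsmul (k := k) (0 : B) 0
      simp only [bchTerm, h3, mul_one, sub_self]
      refine Finset.sum_eq_zero fun j hj => ?_
      rw [zero_pow (by simp at hj; omega), map_zero, smul_zero]
    intro N
    simp [h2]
  simpa using hc.sub_mem (s := 0) hF hx hy (F 1).zero_mem (F 1).zero_mem (by simpa using hx)
    (by simpa using hy) h0

end ExpLog

end

/-! ### The filtration of `Hom(H, A)` is complete and multiplicative. -/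

noncomputable section

section Filtration

variable {k H A : Type*} [Field k] [CommRing H] [HopfAlgebra k H] [CommRing A] [Algebra k A]
  {𝒜 : ℕ → Submodule k H}

theorem mem_fil {n : ℕ} {f : ConvHom k H A} : f ∈ fil 𝒜 n ↔ ∀ m < n, ∀ h ∈ 𝒜 m, f h = 0 :=
  Iff.rfl


/-- The coproduct in degree `d < m + n` lies in the sum of the `H_i ⊗ H_j` with `i + j = d`, where
`i < m` or `j < n`. -/
theorem mul_mem_fil (h𝒜 : IsConnectedGraded 𝒜) {m n : ℕ} {f g : ConvHom k H A}
    (hf : f ∈ fil 𝒜 m) (hg : g ∈ fil 𝒜 n) :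
    f * g ∈ fil 𝒜 (m + n) := by
  intro d hd h hh
  rw [LinearMap.convMul_apply]
  suffices (⨆ p ∈ Finset.HasAntidiagonal.antidiagonal d,
      LinearMap.range (TensorProduct.map (𝒜 p.1).subtype (𝒜 p.2).subtype)) ≤
      LinearMap.ker (LinearMap.mul' k A ∘ₗ TensorProduct.map f.ofConv g.ofConv) from
    this (h𝒜.comul_mem d h hh)
  refine iSup₂_le fun p hp => ?_
  rw [Finset.HasAntidiagonal.mem_antidiagonal] at hp
  rw [LinearMap.range_le_ker_iff]
  ext x y
  have : f x * g y = 0 := by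
    rcases (by omega : p.1 < m ∨ p.2 < n) with h | h
    · rw [hf _ h _ x.2, zero_mul]
    · rw [hg _ h _ y.2, mul_zero]
  simpa using this

theorem toHom_sub_one_mem (h𝒜 : IsConnectedGraded 𝒜) (φ : Character k H A) :
    φ.toHom - 1 ∈ fil 𝒜 1 := by
  intro m hm h hh
  obtain rfl : m = 0 := by omega
  rw [h𝒜.connected] at hh
  obtain ⟨c, rfl⟩ := hh
  change φ.ofConv (algebraMap k H c) - algebraMap k A (Coalgebra.counit (algebraMap k H c)) = 0
  simp

variable [GradedAlgebra 𝒜]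

theorem eq_zero_of_forall_mem_fil {f : ConvHom k H A} (h : ∀ n, f ∈ fil 𝒜 n) : f = 0 := by
  ext x
  induction x using DirectSum.Decomposition.inductionOn 𝒜 with
  | zero => simp
  | homogeneous m => exact h _ _ (Nat.lt_succ_self _) _ m.2
  | add a b ha hb => rw [map_add, ha, hb, map_add]

theorem fil_complete (u : ℕ → ConvHom k H A)
    (hu : ∀ N, ∀ᶠ n in atTop, u (n + 1) - u n ∈ fil 𝒜 N) :
    ∃ f, ∀ N, ∀ᶠ n in atTop, u n - f ∈ fil 𝒜 N := by
  simp only [eventually_atTop] at hu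
  choose a ha using hu
  have hc : ∀ N n, a N ≤ n → u n - u (a N) ∈ fil 𝒜 N := fun N n hn => by
    induction n, hn using Nat.le_induction with
    | base => simp
    | succ n hn ih => simpa using (fil 𝒜 N).add_mem (ha N n hn) ih
  -- On `H_m` the sequence is constant from index `a (m + 1)` on; the limit takes this stable value.
  let f : H →ₗ[k] A := DirectSum.toModule k ℕ A
    (fun m => (u (a (m + 1))).ofConv ∘ₗ (𝒜 m).subtype) ∘ₗ
      (DirectSum.decomposeLinearEquiv 𝒜).toLinearMap
  have hf : ∀ m, ∀ h ∈ 𝒜 m, f h = u (a (m + 1)) h := fun m h hh => by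
    simp only [f, LinearMap.comp_apply, LinearEquiv.coe_coe, DirectSum.decomposeLinearEquiv_apply]
    rw [DirectSum.decompose_of_mem 𝒜 hh]
    exact DirectSum.toModule_lof k m _
  refine ⟨WithConv.toConv f, fun N => ?_⟩
  -- The sum serves as a common upper bound for the finitely many thresholds.
  filter_upwards [eventually_ge_atTop (∑ m ∈ Finset.range N, a (m + 1))] with n hn
  intro m hm h hh
  have h1 := hc (m + 1) n ((Finset.single_le_sum (f := fun m => a (m + 1))
    (fun _ _ => Nat.zero_le _) (Finset.mem_range.mpr hm)).trans hn) m (Nat.lt_succ_self m) h hh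
  have h2 := hf m h hh
  change u n h - f h = 0
  rw [h2]
  exact h1

theorem isCompleteFiltration_fil (h𝒜 : IsConnectedGraded 𝒜) :
    IsCompleteFiltration (fil 𝒜 : ℕ → Submodule k (ConvHom k H A)) where
  antitone m n hmn f hf d hd := hf d (hd.trans_le hmn)
  zero_eq_top := by
    ext f
    simp [mem_fil]
  mul_mem hf hg := mul_mem_fil h𝒜 hf hg
  separated f hf := eq_zero_of_forall_mem_fil hf
  complete := fil_complete

end Filtration

section Characters

variable {k H A : Type*} [Field k] [CommRing H] [HopfAlgebra k H] [CommRing A] [Algebra k A]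

theorem toHom_mul (φ ψ : Character k H A) : (φ * ψ).toHom = φ.toHom * ψ.toHom := rfl

theorem toHom_one : (1 : Character k H A).toHom = 1 := rfl

theorem toHom_pow (φ : Character k H A) (n : ℕ) : (φ ^ n).toHom = φ.toHom ^ n :=
  AlgHom.toLinearMap_convPow φ n

theorem toHom_injective : Function.Injective (Character.toHom : Character k H A → _) := by
  intro φ ψ h
  ext x
  exact congrArg (fun f : ConvHom k H A => f x) h

end Characters
end

/-! ### Infinitesimal characters are exactly the logarithms of characters. -/

noncomputable section

/-- `A` may have zero divisors, so linear functionals `A → k` are applied to the coefficients: the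
resulting polynomial over `k` has infinitely many roots, and functionals separate points. -/
theorem polynomial_eq_zero_of_eval_natCast (k : Type*) {A : Type*} [Field k] [CharZero k]
    [CommRing A] [Algebra k A] {p : Polynomial A} (h : ∀ n : ℕ, p.eval (n : A) = 0) : p = 0 := by
  ext i
  rw [Polynomial.coeff_zero, ← Module.forall_dual_apply_eq_zero_iff k]
  intro l
  set q : Polynomial k := ∑ j ∈ Finset.range (p.natDegree + 1), Polynomial.monomial j (l (p.coeff j))
    with hq
  have hq0 : q = 0 := by
    refine Polynomial.eq_zero_of_infinite_isRoot q
      ((Set.infinite_range_of_injective (Nat.cast_injective (R := k))).mono ?_)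
    rintro _ ⟨n, rfl⟩
    have h1 := congrArg l (h n)
    rw [Polynomial.eval_eq_sum_range, map_sum, map_zero] at h1
    simp only [Set.mem_ofPred_eq, Polynomial.IsRoot, hq, Polynomial.eval_finsetSum,
      Polynomial.eval_monomial]
    rw [← h1]
    refine Finset.sum_congr rfl fun j _ => ?_
    rw [← Nat.cast_pow, ← Nat.cast_pow, mul_comm (p.coeff j), ← nsmul_eq_mul, map_nsmul,
      nsmul_eq_mul, mul_comm]
  by_cases hi : i < p.natDegree + 1
  · have := congrArg (fun r => Polynomial.coeff r i) hq0
    simpa [hq, Polynomial.finsetSum_coeff, Polynomial.coeff_monomial, hi] using this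
  · rw [Polynomial.coeff_eq_zero_of_natDegree_lt (by omega), map_zero]

variable {k H A : Type*} [Field k] [CommRing H] [HopfAlgebra k H] [CommRing A] [Algebra k A]

section Convolution

theorem convMul_apply_mul (f g : ConvHom k H A) (c d : H) :
    (f * g) (c * d) = ∑ i ∈ (Coalgebra.Repr.arbitrary k c).index,
      ∑ j ∈ (Coalgebra.Repr.arbitrary k d).index,
        f ((Coalgebra.Repr.arbitrary k c).left i * (Coalgebra.Repr.arbitrary k d).left j) *
        g ((Coalgebra.Repr.arbitrary k c).right i * (Coalgebra.Repr.arbitrary k d).right j) := by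
  rw [((Coalgebra.Repr.arbitrary k c).mul (Coalgebra.Repr.arbitrary k d)).convMul_apply]
  exact Finset.sum_product _ _ _

/-- Convolution is compatible with products of linear maps on `H × H`. -/
theorem convMul_apply_mul_of_apply_mul {ι κ : Type*} {s : Finset ι} {t : Finset κ}
    {f g : ConvHom k H A} {a b : ι → ConvHom k H A} {a' b' : κ → ConvHom k H A}
    (hf : ∀ c d, f (c * d) = ∑ i ∈ s, a i c * b i d)
    (hg : ∀ c d, g (c * d) = ∑ i ∈ t, a' i c * b' i d) (c d : H) :
    (f * g) (c * d) = ∑ i ∈ s, ∑ j ∈ t, (a i * a' j) c * (b i * b' j) d := by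
  rw [convMul_apply_mul]
  simp only [hf, hg, (Coalgebra.Repr.arbitrary k c).convMul_apply,
    (Coalgebra.Repr.arbitrary k d).convMul_apply, Finset.sum_mul_sum]
  rw [Finset.sum_congr rfl fun m _ => Finset.sum_comm, Finset.sum_comm]
  refine Finset.sum_congr rfl fun i _ => ?_
  rw [Finset.sum_congr rfl fun m _ => Finset.sum_comm, Finset.sum_comm]
  refine Finset.sum_congr rfl fun j _ => Finset.sum_congr rfl fun m _ =>
    Finset.sum_congr rfl fun n _ => ?_
  ring

theorem nsmul_conv_apply (n : ℕ) (f : ConvHom k H A) (h : H) : (n • f) h = n • f h := rfl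

theorem mem_infChar {L : ConvHom k H A} : L ∈ infChar k H A ↔ ∀ c d : H, L (c * d) =
    Coalgebra.counit (R := k) c • L d + Coalgebra.counit (R := k) d • L c :=
  Iff.rfl

theorem pow_apply_mul {L : ConvHom k H A} (hL : L ∈ infChar k H A) (n : ℕ) (c d : H) :
    (L ^ n) (c * d) = ∑ p ∈ Finset.HasAntidiagonal.antidiagonal n,
      n.choose p.1 * ((L ^ p.1) c * (L ^ p.2) d) := by
  induction n generalizing c d with
  | zero => simp
  | succ n ih =>
    -- On products `L` acts as `1 ⊗ L + L ⊗ 1`; the two summands commute under convolution, and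
    -- Pascal's rule gives the induction step.
    have hL' : ∀ c d, L (c * d) = ∑ i : Bool,
        (if i then 1 else L : ConvHom k H A) c * (if i then L else 1 : ConvHom k H A) d := by
      intro c d
      rw [mem_infChar.mp hL c d]
      simp [Algebra.smul_def, mul_comm]
    have ih' : ∀ c d, (L ^ n) (c * d) = ∑ p ∈ Finset.HasAntidiagonal.antidiagonal n,
        (n.choose p.1 • L ^ p.1 : ConvHom k H A) c * (L ^ p.2) d := by
      intro c d
      rw [ih]
      refine Finset.sum_congr rfl fun p _ => ?_
      rw [nsmul_conv_apply, nsmul_eq_mul, mul_assoc]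
    rw [pow_succ, convMul_apply_mul_of_apply_mul ih' hL',
      Finset.sum_antidiagonal_choose_succ_mul (fun i j => (L ^ i) c * (L ^ j) d),
      ← Finset.sum_add_distrib]
    refine Finset.sum_congr rfl fun p hp => ?_
    rw [Finset.HasAntidiagonal.mem_antidiagonal] at hp
    rw [← Nat.choose_symm_of_eq_add (by omega : n = p.1 + p.2)]
    simp only [Fintype.sum_bool, if_true, Bool.false_eq_true, if_false, mul_one, smul_mul_assoc,
      nsmul_conv_apply, ← pow_succ]
    simp only [nsmul_eq_mul]

theorem exists_character {f : ConvHom k H A} (h1 : f 1 = 1) (h : ∀ c d, f (c * d) = f c * f d) :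
    ∃ φ : Character k H A, φ.toHom = f :=
  ⟨WithConv.toConv (AlgHom.ofLinearMap f.ofConv h1 h), rfl⟩

end Convolution

variable {𝒜 : ℕ → Submodule k H} [GradedAlgebra 𝒜]

theorem Converges.eventually_apply_eq {u : ℕ → ConvHom k H A} {f : ConvHom k H A}
    (hu : Converges (fil 𝒜) u f) (h : H) : ∀ᶠ n in atTop, u n h = f h := by
  induction h using DirectSum.Decomposition.inductionOn 𝒜 with
  | zero => simp
  | @homogeneous i m =>
    filter_upwards [hu (i + 1)] with n hn
    exact sub_eq_zero.mp (hn i (Nat.lt_succ_self i) m m.2)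
  | add a b ha hb =>
    filter_upwards [ha, hb] with n h1 h2
    rw [map_add, map_add, h1, h2]

theorem infChar_closed {u : ℕ → ConvHom k H A} {f : ConvHom k H A}
    (hu : Converges (fil 𝒜) u f) (h : ∀ n, u n ∈ infChar k H A) : f ∈ infChar k H A := by
  intro c d
  obtain ⟨n, h1, h2, h3⟩ := ((hu.eventually_apply_eq c).and
    ((hu.eventually_apply_eq d).and (hu.eventually_apply_eq (c * d)))).exists
  rw [← h1, ← h2, ← h3]
  exact h n c d

variable (h𝒜 : IsConnectedGraded 𝒜)
include h𝒜

/-- The polynomial is `t ↦ exp (t L) h`; it is finite because high powers of `L` vanish at `h`. -/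
theorem exists_expPolynomial {L : ConvHom k H A} (hL : L ∈ fil 𝒜 1) (h : H) :
    ∃ p : Polynomial A, ∀ n, p.coeff n = ((n.factorial : k)⁻¹) • (L ^ n) h := by
  have hF := isCompleteFiltration_fil (A := A) h𝒜
  have h0 : Converges (fil 𝒜) (fun n => L ^ n) 0 := fun N => by
    filter_upwards [eventually_ge_atTop N] with n hn
    rw [sub_zero]
    exact hF.antitone hn (hF.pow_mem_of_mem_one hL n)
  obtain ⟨N, hN⟩ := eventually_atTop.mp (h0.eventually_apply_eq h)
  refine ⟨∑ n ∈ Finset.range N, Polynomial.monomial n (((n.factorial : k)⁻¹) • (L ^ n) h),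
    fun n => ?_⟩
  simp only [Polynomial.finsetSum_coeff, Polynomial.coeff_monomial, Finset.sum_ite_eq',
    Finset.mem_range]
  split_ifs with hn
  · rfl
  · rw [hN n (not_lt.mp hn)]
    simp

variable [CharZero k]

theorem pow_apply_eq_eval {L e : ConvHom k H A} (hL : L ∈ fil 𝒜 1) (he : IsExp (fil 𝒜) L e)
    {h : H} {p : Polynomial A} (hp : ∀ n, p.coeff n = ((n.factorial : k)⁻¹) • (L ^ n) h) (n : ℕ) :
    (e ^ n) h = p.eval (n : A) := by
  have hF := isCompleteFiltration_fil (A := A) h𝒜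
  obtain ⟨M, h1, h2⟩ := (((he.nsmul hF hL n).eventually_apply_eq h).and
    (eventually_gt_atTop p.natDegree)).exists
  rw [← h1, Polynomial.eval_eq_sum_range' h2]
  simp only [WithConv.ofConv_sum, LinearMap.sum_apply]
  refine Finset.sum_congr rfl fun i _ => ?_
  rw [hp, smul_pow, WithConv.ofConv_smul, LinearMap.smul_apply, nsmul_conv_apply, smul_mul_assoc,
    nsmul_eq_mul, Nat.cast_pow, mul_comm]

theorem IsExp.exists_character {L e : ConvHom k H A} (hL : L ∈ fil 𝒜 1)
    (hi : L ∈ infChar k H A) (he : IsExp (fil 𝒜) L e) : ∃ φ : Character k H A, φ.toHom = e := by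
  have hF := isCompleteFiltration_fil (A := A) h𝒜
  refine HopfFactorization.exists_character ?_ fun c d => ?_
  · have h1 := he.sub_one_mem hF hL 0 Nat.zero_lt_one 1 SetLike.GradedOne.one_mem
    have h2 : e 1 - (1 : ConvHom k H A) 1 = 0 := h1
    simpa [sub_eq_zero] using h2
  · obtain ⟨p, hp⟩ := exists_expPolynomial h𝒜 hL c
    obtain ⟨q, hq⟩ := exists_expPolynomial h𝒜 hL d
    -- By the binomial formula the polynomial of `c * d` is the product of those of `c` and `d`;
    -- evaluating at `1` gives multiplicativity.
    have hpq : ∀ n, (p * q).coeff n = ((n.factorial : k)⁻¹) • (L ^ n) (c * d) := fun n => by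
      rw [Polynomial.coeff_mul, pow_apply_mul hi, Finset.smul_sum]
      refine Finset.sum_congr rfl fun i hi => ?_
      rw [Finset.HasAntidiagonal.mem_antidiagonal] at hi
      subst hi
      rw [hp, hq, smul_mul_smul_comm, ← nsmul_eq_mul, ← Nat.cast_smul_eq_nsmul k, smul_smul]
      congr 1
      rw [Nat.choose_symm_add, Nat.add_choose, Nat.cast_div
        (Nat.factorial_mul_factorial_dvd_factorial_add _ _)
        (by simp [Nat.factorial_ne_zero])]
      have := Nat.cast_ne_zero (R := k).mpr (i.1 + i.2).factorial_ne_zero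
      have := Nat.cast_ne_zero (R := k).mpr i.1.factorial_ne_zero
      have := Nat.cast_ne_zero (R := k).mpr i.2.factorial_ne_zero
      push_cast
      field_simp
    have h1 := pow_apply_eq_eval h𝒜 hL he hp 1
    have h2 := pow_apply_eq_eval h𝒜 hL he hq 1
    have h3 := pow_apply_eq_eval h𝒜 hL he hpq 1
    rw [Polynomial.eval_mul, ← h1, ← h2] at h3
    simpa using h3

theorem IsExp.mem_infChar {L : ConvHom k H A} (hL : L ∈ fil 𝒜 1) {φ : Character k H A}
    (he : IsExp (fil 𝒜) L φ.toHom) : L ∈ infChar k H A := by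
  intro c d
  obtain ⟨p, hp⟩ := exists_expPolynomial h𝒜 hL c
  obtain ⟨q, hq⟩ := exists_expPolynomial h𝒜 hL d
  obtain ⟨r, hr⟩ := exists_expPolynomial h𝒜 hL (c * d)
  -- At each natural number `n` this is multiplicativity of the character `φ ^ n`. The coefficient
  -- of degree one is the identity sought.
  have h : r - p * q = 0 := polynomial_eq_zero_of_eval_natCast k fun n => by
    rw [Polynomial.eval_sub, Polynomial.eval_mul, ← pow_apply_eq_eval h𝒜 hL he hp,
      ← pow_apply_eq_eval h𝒜 hL he hq, ← pow_apply_eq_eval h𝒜 hL he hr, ← toHom_pow]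
    exact sub_eq_zero.mpr (map_mul (φ ^ n).ofConv c d)
  have h1 := congrArg (fun r => Polynomial.coeff r 1) h
  simp only [Polynomial.coeff_sub, Polynomial.coeff_mul, hp, hq, hr,
    Finset.Nat.antidiagonal_succ] at h1
  simp only [Algebra.smul_def]
  simp [sub_eq_zero] at h1
  rw [h1]
  ring

end

/-! ### The CBHD recursion and its fixed point. -/

noncomputable section

variable {k H A : Type*} [Field k] [CommRing H] [HopfAlgebra k H] [CommRing A] [Algebra k A]
  {𝒜 : ℕ → Submodule k H}

theorem filTendsto_filLim {u : ℕ → ConvHom k H A} {f : ConvHom k H A} (h : FilTendsto 𝒜 u f) :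
    FilTendsto 𝒜 u (filLim 𝒜 u) :=
  Classical.epsilon_spec (p := fun f => FilTendsto 𝒜 u f) ⟨f, h⟩

theorem fil_sub_mem {n : ℕ} {f g : ConvHom k H A} (hf : f ∈ fil 𝒜 n) (hg : g ∈ fil 𝒜 n) :
    f - g ∈ fil 𝒜 n := by
  intro m hm h hh
  change f h - g h = 0
  rw [hf m hm h hh, hg m hm h hh, sub_zero]

theorem fil_neg_mem {n : ℕ} {f : ConvHom k H A} (hf : f ∈ fil 𝒜 n) : -f ∈ fil 𝒜 n := by
  simpa using fil_sub_mem (fil 𝒜 n).zero_mem hf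

theorem fil_sub_mem_comm {n : ℕ} {f g : ConvHom k H A} (h : f - g ∈ fil 𝒜 n) :
    g - f ∈ fil 𝒜 n := by
  simpa using fil_neg_mem h

theorem infChar_sub_mem {f g : ConvHom k H A} (hf : f ∈ infChar k H A) (hg : g ∈ infChar k H A) :
    f - g ∈ infChar k H A := by
  intro c d
  change f (c * d) - g (c * d) = _ • (f d - g d) + _ • (f c - g c)
  rw [hf c d, hg c d, smul_sub, smul_sub]
  abel

theorem infChar_neg_mem {f : ConvHom k H A} (hf : f ∈ infChar k H A) : -f ∈ infChar k H A := by
  simpa using infChar_sub_mem (infChar k H A).zero_mem hf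

section Decomposition

variable {P : ConvHom k H A →ₗ[k] ConvHom k H A}

theorem tilde_apply (f : ConvHom k H A) : tilde P f = f - P f := rfl

theorem tilde_add_apply (f : ConvHom k H A) : tilde P f + P f = f := by
  rw [tilde_apply, sub_add_cancel]

theorem tilde_mem (hP : ∀ n, ∀ f ∈ fil 𝒜 n, P f ∈ fil 𝒜 n) {n : ℕ} {f : ConvHom k H A}
    (hf : f ∈ fil 𝒜 n) : tilde P f ∈ fil 𝒜 n :=
  fil_sub_mem hf (hP n f hf)

end Decomposition

variable [GradedAlgebra 𝒜] [CharZero k] (h𝒜 : IsConnectedGraded 𝒜)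
include h𝒜

theorem isExp_convExp {f : ConvHom k H A} (hf : f ∈ fil 𝒜 1) :
    IsExp (fil 𝒜) f (convExp 𝒜 f) := by
  obtain ⟨e, he⟩ := exists_isExp (isCompleteFiltration_fil h𝒜) hf
  exact filTendsto_filLim he

theorem isLog_convLog {g : ConvHom k H A} (hg : g - 1 ∈ fil 𝒜 1) :
    IsLog (fil 𝒜) g (convLog 𝒜 g) := by
  obtain ⟨l, -, hl, -⟩ := exists_isLog (isCompleteFiltration_fil h𝒜) hg
  exact filTendsto_filLim hl

theorem isBch_cbhd {x y : ConvHom k H A} (hx : x ∈ fil 𝒜 1) (hy : y ∈ fil 𝒜 1) :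
    IsBch (fil 𝒜) x y (cbhd 𝒜 x y) := by
  obtain ⟨c, hc, -⟩ := exists_isBch (isCompleteFiltration_fil h𝒜) hx hy
    (isExp_convExp h𝒜 hx) (isExp_convExp h𝒜 hy)
  exact filTendsto_filLim hc

theorem cbhd_mem {x y : ConvHom k H A} (hx : x ∈ fil 𝒜 1) (hy : y ∈ fil 𝒜 1) :
    cbhd 𝒜 x y ∈ fil 𝒜 1 :=
  (isCompleteFiltration_fil h𝒜).antitone one_le_two
    ((isBch_cbhd h𝒜 hx hy).mem (isCompleteFiltration_fil h𝒜) hx hy)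

theorem isExp_add_cbhd {x y : ConvHom k H A} (hx : x ∈ fil 𝒜 1) (hy : y ∈ fil 𝒜 1) :
    IsExp (fil 𝒜) (x + y + cbhd 𝒜 x y) (convExp 𝒜 x * convExp 𝒜 y) := by
  have hF := isCompleteFiltration_fil (A := A) h𝒜
  have ex := isExp_convExp h𝒜 hx
  have ey := isExp_convExp h𝒜 hy
  refine ((isBch_cbhd h𝒜 hx hy).isLog hF hx hy ex ey).isExp hF ?_
  have h1 := hF.mul_mem_right (ex.sub_one_mem hF hx) (convExp 𝒜 y)
  convert (fil 𝒜 1).add_mem h1 (ey.sub_one_mem hF hy) using 1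
  noncomm_ring

/-- The product of the characters `exp x` and `exp y` is a character, so its logarithm `x + y +
CBHD(x, y)` is infinitesimal. -/
theorem cbhd_mem_infChar {x y : ConvHom k H A} (hx : x ∈ fil 𝒜 1) (hy : y ∈ fil 𝒜 1)
    (hxi : x ∈ infChar k H A) (hyi : y ∈ infChar k H A) : cbhd 𝒜 x y ∈ infChar k H A := by
  obtain ⟨φ, hφ⟩ := (isExp_convExp h𝒜 hx).exists_character h𝒜 hx hxi
  obtain ⟨ψ, hψ⟩ := (isExp_convExp h𝒜 hy).exists_character h𝒜 hy hyi
  have h := isExp_add_cbhd h𝒜 hx hy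
  rw [← hφ, ← hψ, ← toHom_mul] at h
  have h1 := h.mem_infChar h𝒜
    ((fil 𝒜 1).add_mem ((fil 𝒜 1).add_mem hx hy) (cbhd_mem h𝒜 hx hy))
  simpa using infChar_sub_mem h1 ((infChar k H A).add_mem hxi hyi)

section Chi

variable {P : ConvHom k H A →ₗ[k] ConvHom k H A}

theorem chiIter_mem_infChar (hP : ∀ n, ∀ f ∈ fil 𝒜 n, P f ∈ fil 𝒜 n)
    (hPi : ∀ L ∈ infChar k H A, P L ∈ infChar k H A) {a : ConvHom k H A} (ha : a ∈ fil 𝒜 1)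
    (hai : a ∈ infChar k H A) (n : ℕ) :
    chiIter 𝒜 P a n ∈ fil 𝒜 1 ∧ chiIter 𝒜 P a n ∈ infChar k H A := by
  induction n with
  | zero => exact ⟨ha, hai⟩
  | succ n ih =>
    have h1 := tilde_mem hP ih.1
    have h2 := hP 1 _ ih.1
    exact ⟨fil_sub_mem ha (cbhd_mem h𝒜 h1 h2),
      infChar_sub_mem hai (cbhd_mem_infChar h𝒜 h1 h2
        (infChar_sub_mem ih.2 (hPi _ ih.2)) (hPi _ ih.2))⟩

variable (hP : ∀ n, ∀ f ∈ fil 𝒜 n, P f ∈ fil 𝒜 n)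
include hP

theorem cbhd_tilde_sub_mem {s : ℕ} {f g : ConvHom k H A} (hf : f ∈ fil 𝒜 1) (hg : g ∈ fil 𝒜 1)
    (h : f - g ∈ fil 𝒜 (s + 1)) :
    cbhd 𝒜 (tilde P f) (P f) - cbhd 𝒜 (tilde P g) (P g) ∈ fil 𝒜 (s + 2) :=
  (isBch_cbhd h𝒜 (tilde_mem hP hf) (hP 1 f hf)).sub_mem (isCompleteFiltration_fil h𝒜)
    (tilde_mem hP hf) (hP 1 f hf) (tilde_mem hP hg) (hP 1 g hg)
    (by rw [← map_sub]; exact tilde_mem hP h) (by rw [← map_sub]; exact hP _ _ h)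
    (isBch_cbhd h𝒜 (tilde_mem hP hg) (hP 1 g hg))

theorem chiIter_mem {a : ConvHom k H A} (ha : a ∈ fil 𝒜 1) (n : ℕ) :
    chiIter 𝒜 P a n ∈ fil 𝒜 1 := by
  induction n with
  | zero => exact ha
  | succ n ih => exact fil_sub_mem ha (cbhd_mem h𝒜 (tilde_mem hP ih) (hP 1 _ ih))

theorem chiIter_succ_sub_mem {a : ConvHom k H A} (ha : a ∈ fil 𝒜 1) (n : ℕ) :
    chiIter 𝒜 P a (n + 1) - chiIter 𝒜 P a n ∈ fil 𝒜 (n + 1) := by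
  induction n with
  | zero =>
    exact fil_sub_mem (chiIter_mem h𝒜 hP ha 1) (chiIter_mem h𝒜 hP ha 0)
  | succ n ih =>
    have h := cbhd_tilde_sub_mem h𝒜 hP (chiIter_mem h𝒜 hP ha (n + 1)) (chiIter_mem h𝒜 hP ha n) ih
    rw [chiIter, chiIter, sub_sub_sub_cancel_left]
    exact fil_sub_mem_comm h

theorem converges_chi {a : ConvHom k H A} (ha : a ∈ fil 𝒜 1) :
    Converges (fil 𝒜) (chiIter 𝒜 P a) (chi 𝒜 P a) := by
  obtain ⟨f, hf⟩ := fil_complete (chiIter 𝒜 P a) fun N => by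
    filter_upwards [eventually_ge_atTop N] with n hn
    exact (isCompleteFiltration_fil h𝒜).antitone (by omega) (chiIter_succ_sub_mem h𝒜 hP ha n)
  exact filTendsto_filLim hf

theorem chi_mem {a : ConvHom k H A} (ha : a ∈ fil 𝒜 1) : chi 𝒜 P a ∈ fil 𝒜 1 :=
  (converges_chi h𝒜 hP ha).mem (Eventually.of_forall (chiIter_mem h𝒜 hP ha))

/-- The contraction estimate provides the continuity needed to pass to the limit in the recursion.
-/
theorem chi_eq {a : ConvHom k H A} (ha : a ∈ fil 𝒜 1) :
    chi 𝒜 P a = a - cbhd 𝒜 (tilde P (chi 𝒜 P a)) (P (chi 𝒜 P a)) := by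
  have hc := converges_chi h𝒜 hP ha
  have hF := isCompleteFiltration_fil (A := A) h𝒜
  refine hF.unique (u := fun n => chiIter 𝒜 P a (n + 1))
    (fun N => (tendsto_add_atTop_nat 1).eventually (hc N)) fun N => ?_
  filter_upwards [hc (N + 1)] with n hn
  rw [chiIter, sub_sub_sub_cancel_left]
  exact fil_sub_mem_comm (hF.antitone (N.le_add_right 2)
    (cbhd_tilde_sub_mem h𝒜 hP (chiIter_mem h𝒜 hP ha n) (chi_mem h𝒜 hP ha) hn))

theorem fixedPoint_unique {a f g : ConvHom k H A} (hf : f ∈ fil 𝒜 1) (hg : g ∈ fil 𝒜 1)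
    (hf' : f = a - cbhd 𝒜 (tilde P f) (P f)) (hg' : g = a - cbhd 𝒜 (tilde P g) (P g)) :
    f = g := by
  have hF := isCompleteFiltration_fil (A := A) h𝒜
  have key : ∀ n, f - g ∈ fil 𝒜 (n + 1) := fun n => by
    induction n with
    | zero => exact fil_sub_mem hf hg
    | succ n ih =>
      have h := fil_sub_mem_comm (cbhd_tilde_sub_mem h𝒜 hP hf hg ih)
      rwa [← sub_sub_sub_cancel_left _ _ a, ← hf', ← hg'] at h
  exact hF.eq_of_sub_mem fun n => hF.antitone n.le_succ (key n)

theorem isExp_chi {a : ConvHom k H A} (ha : a ∈ fil 𝒜 1) :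
    IsExp (fil 𝒜) a (convExp 𝒜 (tilde P (chi 𝒜 P a)) * convExp 𝒜 (P (chi 𝒜 P a))) := by
  have hX := chi_mem h𝒜 hP ha
  have h := isExp_add_cbhd h𝒜 (tilde_mem hP hX) (hP 1 _ hX)
  rwa [tilde_add_apply, eq_sub_iff_add_eq.mp (chi_eq h𝒜 hP ha)] at h

end Chi

theorem convExp_mul_convExp_neg {f : ConvHom k H A} (hf : f ∈ fil 𝒜 1) :
    convExp 𝒜 f * convExp 𝒜 (-f) = 1 :=
  (isExp_convExp h𝒜 hf).mul_neg (isCompleteFiltration_fil h𝒜) hf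
    (isExp_convExp h𝒜 (fil_neg_mem hf))

theorem convExp_neg_mul_convExp {f : ConvHom k H A} (hf : f ∈ fil 𝒜 1) :
    convExp 𝒜 (-f) * convExp 𝒜 f = 1 := by
  have h := convExp_mul_convExp_neg h𝒜 (fil_neg_mem hf)
  rwa [neg_neg] at h

end

end HopfFactorization

/-! ### The factorization theorem. -/

theorem mainTheorem9 {k H A : Type*} [Field k] [CharZero k] [CommRing H] [HopfAlgebra k H]
    [CommRing A] [Algebra k A] (𝒜 : ℕ → Submodule k H) [GradedAlgebra 𝒜]
    (h𝒜 : IsConnectedGraded 𝒜) (P : ConvHom k H A →ₗ[k] ConvHom k H A)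
    (hP : ∀ n, ∀ f ∈ fil 𝒜 n, P f ∈ fil 𝒜 n) :
    -- all series and limits that define `exp`, `log`, `CBHD` and `χ` converge
    (∀ f ∈ fil (A := A) 𝒜 1,
      FilHasSum 𝒜 (expTerm f) (convExp 𝒜 f)) ∧
    (∀ g : ConvHom k H A, g - 1 ∈ fil 𝒜 1 →
      FilHasSum 𝒜 (logTerm g) (convLog 𝒜 g)) ∧
    (∀ x ∈ fil (A := A) 𝒜 1, ∀ y ∈ fil (A := A) 𝒜 1,
      FilHasSum 𝒜 (fun m => bchTerm k (m + 2) x y)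
        (cbhd 𝒜 x y)) ∧
    (∀ a ∈ fil (A := A) 𝒜 1,
      FilTendsto 𝒜 (chiIter 𝒜 P a) (chi 𝒜 P a) ∧
      chi 𝒜 P a ∈ fil 𝒜 1) ∧
    ∀ (φ : Character k H A) (Z X : ConvHom k H A),
      Z = convLog 𝒜 φ.toHom → X = chi 𝒜 P Z →
      φ.toHom - 1 ∈ fil 𝒜 1 ∧
      Z ∈ infChar k H A ∧ Z ∈ fil 𝒜 1 ∧
      -- the factorization `φ = φ₋⁻¹ * φ₊` in `Hom(H, A)`
      (∃ φm φp : (ConvHom k H A)ˣ,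
        (↑φm⁻¹ : ConvHom k H A) = convExp 𝒜 (tilde P X) ∧
        (↑φp : ConvHom k H A) = convExp 𝒜 (P X) ∧
        φ.toHom = ↑φm⁻¹ * ↑φp) ∧
      -- if `P` acts on infinitesimal characters, the factors are characters
      ((∀ L ∈ infChar k H A, P L ∈ infChar k H A) →
        X ∈ infChar k H A ∧
        ∃ (φm : (Character k H A)ˣ) (φp : Character k H A),
          (↑φm⁻¹ : Character k H A).toHom = convExp 𝒜 (tilde P X) ∧
          φp.toHom = convExp 𝒜 (P X) ∧
          φ = ↑φm⁻¹ * φp) ∧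
      -- uniqueness for idempotent `P`
      (P ∘ₗ P = P →
        ∀ x y : ConvHom k H A,
          (∃ a ∈ fil 𝒜 1, x = convExp 𝒜 (tilde P a)) →
          (∃ b ∈ fil 𝒜 1, y = convExp 𝒜 (P b)) →
          φ.toHom = x * y →
          x = convExp 𝒜 (tilde P X) ∧ y = convExp 𝒜 (P X)) := by
  have hF := isCompleteFiltration_fil (A := A) h𝒜
  refine ⟨fun f hf => isExp_convExp h𝒜 hf, fun g hg => isLog_convLog h𝒜 hg,
    fun x hx y hy => isBch_cbhd h𝒜 hx hy,
    fun a ha => ⟨converges_chi h𝒜 hP ha, chi_mem h𝒜 hP ha⟩, ?_⟩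
  rintro φ Z X hZ rfl
  have hφ := toHom_sub_one_mem h𝒜 φ
  have hlog : IsLog (fil 𝒜) φ.toHom Z := hZ ▸ isLog_convLog h𝒜 hφ
  have hZ1 := hlog.mem_one hF hφ
  have hexp := hlog.isExp hF hφ
  have hZi := hexp.mem_infChar h𝒜 hZ1
  have hX := chi_mem h𝒜 hP hZ1
  have htX := tilde_mem hP hX
  have hPX := hP 1 _ hX
  have hfac : φ.toHom = convExp 𝒜 (tilde P (chi 𝒜 P Z)) * convExp 𝒜 (P (chi 𝒜 P Z)) :=
    hF.unique hexp (isExp_chi h𝒜 hP hZ1)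
  refine ⟨hφ, hZi, hZ1, ?_, fun hPi => ?_, fun hPP x y => ?_⟩
  -- Here `φ₋` is `exp (-P̃ X)`, with inverse `exp (P̃ X)`.
  · exact ⟨⟨_, _, convExp_neg_mul_convExp h𝒜 htX, convExp_mul_convExp_neg h𝒜 htX⟩,
      ⟨_, _, convExp_mul_convExp_neg h𝒜 hPX, convExp_neg_mul_convExp h𝒜 hPX⟩, rfl, rfl, hfac⟩
  · have hXi : chi 𝒜 P Z ∈ infChar k H A := infChar_closed (converges_chi h𝒜 hP hZ1)
      fun n => (chiIter_mem_infChar h𝒜 hP hPi hZ1 hZi n).2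
    have htXi : tilde P (chi 𝒜 P Z) ∈ infChar k H A := infChar_sub_mem hXi (hPi _ hXi)
    obtain ⟨ψ, hψ⟩ := (isExp_convExp h𝒜 htX).exists_character h𝒜 htX htXi
    obtain ⟨φm, hφm⟩ := (isExp_convExp h𝒜 (fil_neg_mem htX)).exists_character h𝒜
      (fil_neg_mem htX) (infChar_neg_mem htXi)
    obtain ⟨φp, hφp⟩ := (isExp_convExp h𝒜 hPX).exists_character h𝒜 hPX (hPi _ hXi)
    refine ⟨hXi, ⟨φm, ψ, toHom_injective ?_, toHom_injective ?_⟩, φp, hψ, hφp, ?_⟩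
    · rw [toHom_mul, hψ, hφm, toHom_one, convExp_neg_mul_convExp h𝒜 htX]
    · rw [toHom_mul, hψ, hφm, toHom_one, convExp_mul_convExp_neg h𝒜 htX]
    apply toHom_injective
    change φ.toHom = (ψ * φp).toHom
    rw [toHom_mul, hψ, hφp, hfac]
  · rintro ⟨a, ha, rfl⟩ ⟨b, hb, rfl⟩ hxy
    have hPP' : ∀ f, P (P f) = P f := fun f => LinearMap.congr_fun hPP f
    have hta := tilde_mem hP ha
    have hPb := hP 1 _ hb
    -- Idempotence gives `P P̃ = 0`, so `P̃ a + P b` has components `P̃ a` and `P b`. By injectivity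
    -- of `exp` it solves the fixed point equation for `Z`.
    have h1 : P (tilde P a + P b) = P b := by
      rw [map_add, tilde_apply, map_sub, hPP', hPP', sub_self, zero_add]
    have h2 : tilde P (tilde P a + P b) = tilde P a := by
      rw [tilde_apply, h1, add_sub_cancel_right]
    have h3 := isExp_add_cbhd h𝒜 hta hPb
    rw [← hxy] at h3
    have h4 := hexp.injective hF hZ1 ((fil 𝒜 1).add_mem ((fil 𝒜 1).add_mem hta hPb)
      (cbhd_mem h𝒜 hta hPb)) h3
    have h5 : tilde P a + P b = chi 𝒜 P Z := by
      refine fixedPoint_unique h𝒜 hP ((fil 𝒜 1).add_mem hta hPb) hX (a := Z) ?_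
        (chi_eq h𝒜 hP hZ1)
      rw [h1, h2, h4, add_sub_cancel_right]
    rw [← h5, h1, h2]
    exact ⟨rfl, rfl⟩
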